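/- Setting. There are $n \ge 1$ items $1,\dots,n$ with unknown real values $x_1,\dots,x_n$. A comparison of two items $a,b$ returns one of the two: the one with the larger value if $|x_a-x_b|>1$, and otherwise whichever of the two an adversary chooses. A randomized algorithm works in rounds: in each round it submits a batch of comparisons, chosen depending on its random choices so far and on the answers in earlier rounds, and it receives all answers of the batch together; at the end it returns an item. The adversary is adaptive: it knows the algorithm and the values, and its choices may depend on all queries and answers of earlier rounds and on the current batch (but not on future random choices of the algorithm); it need not answer a repeated query consistently. For real $k\ge 0$, an ordering $y_1,\dots,y_n$ of the items is a $k$-approximate sorting if, for all $a<b$, the value of $y_b$ is at least the value of $y_a$ minus $k$. For $1\le i\le n$, an item is a $k$-approximate $i$-selection if it is the $i$-th item $y_i$ of some $k$-approximate sorting $y_1,\dots,y_n$. Corollary 1.2. There is an absolute constant $C$ such that for every $n\ge 1$ and every $1\le i\le n$ there is a randomized algorithm on $n$ items with the following property. For all values $x_1,\dots,x_n\in\mathbb{R}$ and every adaptive adversary, the algorithm always makes at most $C\,n\log n$ comparisons and uses at most $C\log n$ rounds, and with probability $>1-\frac{1}{n^2}$ it returns a $4$-approximate $i$-selection. -/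

import Mathlib

/-- An ordering `e` of the `n` items with values `x` (`e a` is the item at position `a`) is a
`k`-approximate sorting if an item placed later is never smaller by more than `k` than an item
placed earlier. -/
def IsApproxSorting {n : ℕ} (x : Fin n → ℝ) (k : ℝ) (e : Equiv.Perm (Fin n)) : Prop :=
  ∀ a b : Fin n, a < b → x (e b) ≥ x (e a) - k

/-- An item is a `k`-approximate selection for position `i` if it is the item at position `i` of
some `k`-approximate sorting. Positions are numbered from `0`, so `i : Fin n` stands for the
`(i + 1)`-th smallest item. -/
def IsApproxSelection {n : ℕ} (x : Fin n → ℝ) (k : ℝ) (i : Fin n) (item : Fin n) : Prop :=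
  ∃ e : Equiv.Perm (Fin n), IsApproxSorting x k e ∧ e i = item

/-- Round-based randomized comparison algorithms on `n` items. The algorithm knows the names
`Fin n` of the items but not their values. It stops with an item, or draws a fresh uniformly
random element of `Fin (k + 1)`, or submits a batch of `m` comparisons as one parallel round and
continues according to the items which the comparator returned. -/
inductive RoundAlg (n : ℕ) : Type where
  | output (item : Fin n) : RoundAlg n
  | sample (k : ℕ) (next : Fin (k + 1) → RoundAlg n) : RoundAlg n
  | round (m : ℕ) (queries : Fin m → Fin n × Fin n)
      (next : (Fin m → Fin n) → RoundAlg n) : RoundAlg n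

/-- A finished round: the pairs that were compared and the items that were returned. -/
structure PastRound (n : ℕ) where
  size : ℕ
  queries : Fin size → Fin n × Fin n
  answers : Fin size → Fin n

/-- An adaptive adversary. Given all finished rounds (most recent first) and the whole current
batch, it chooses a preferred answer to each comparison of the batch: `true` for the first item
of the pair, `false` for the second. It may answer the same pair differently at different times. -/
abbrev Adversary (n : ℕ) : Type :=
  List (PastRound n) → (m : ℕ) → (Fin m → Fin n × Fin n) → Fin m → Bool

open Classical in
/-- The item returned when the items of the pair `p` are compared: the larger one if the values
differ by more than `1`, and otherwise the one that the adversary prefers. -/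
noncomputable def compareResult {n : ℕ} (x : Fin n → ℝ) (pref : Bool) (p : Fin n × Fin n) :
    Fin n :=
  if 1 < |x p.1 - x p.2| then
    (if x p.2 < x p.1 then p.1 else p.2)
  else
    (if pref = true then p.1 else p.2)

/-- The result of one execution: the returned item and the resources that were used. -/
structure Outcome (n : ℕ) where
  item : Fin n
  comparisons : ℕ
  rounds : ℕ

/-- The distribution of the outcome of an algorithm on items with values `x` against the
adversary `σ`, when the rounds in `past` have been played already. Only the comparisons and rounds
made from now on are counted. -/
noncomputable def RoundAlg.run {n : ℕ} (x : Fin n → ℝ) (σ : Adversary n) :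
    RoundAlg n → List (PastRound n) → PMF (Outcome n)
  | .output item, _ => PMF.pure ⟨item, 0, 0⟩
  | .sample k next, past =>
      (PMF.uniformOfFintype (Fin (k + 1))).bind fun j => (next j).run x σ past
  | .round m queries next, past =>
      let answers : Fin m → Fin n := fun l => compareResult x (σ past m queries l) (queries l)
      ((next answers).run x σ (⟨m, queries, answers⟩ :: past)).map fun o =>
        ⟨o.item, o.comparisons + m, o.rounds + 1⟩

/-!
An item `y` is a `4`-approximate selection for position `i` exactly when few enough values lie below
`y - 4` and above `y + 4` (`IsGood`; see `IsGood.isApproxSelection`). In this form the errors of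
successive steps do not accumulate: if the current `m` items are cut into two parts such that no
value of the lower part exceeds one of the upper part by more than `4`, then a good choice inside
the part that holds the wanted rank is a good choice for all `m` items (`IsGood.of_lower`,
`IsGood.of_upper`). It therefore suffices to find, in two rounds and with `O(m log n)` comparisons,
such a cut in which both parts hold a constant proportion of the items: the sizes shrink
geometrically, and a round robin settles the last fewer than `16` items.

Quicksort with a random pivot does not give balanced cuts, because the adversary can let all items
that are close to the pivot win. Instead, every index `e` is first compared with its shifts
`e + a k` for `d = O(log n)` random shifts `a k` of `Fin m`. Every index then meets `2 * d`
opponents, the items win exactly half of their comparisons on average, and by a Chernoff bound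
(`card_not_representative_le`) the opponents of every index represent all items up to `1 / 100`. So
a clear difference of scores reveals the order of the values up to `2` (`le_of_score_lt`). Three
cases remain for the cut (`lowerPart`, `lowerPart_le`).

* Some item `p` has a score clearly between those of the lowest and the highest sixteenth. All items
  are compared with `p`. The larger of the two sides lies beyond `p` up to an error of `1`. The
  sixteenth at the other extreme of the scores is moved across, so that both parts are large.
* The scores have a gap. The cut is made there.
* All scores but those of the extreme sixteenths almost agree, so they are about half of the
  degree. If the values differed by more than `3`, there would be two groups separated by a nearly
  empty range of values, and the scores in the lower group would be about half as large, on average,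
  as they are (`sum_score_upTo_le`, `le_of_concentrated`). So the lowest sixteenth can be split off.

The sizes of the parts do not depend on luck (`card_lowerPart`), hence the bounds on comparisons and
rounds always hold (`costLE_select`), and only the events that a sample is not representative
contribute to the failure probability (`failLE_select`).
-/

/-! ### Cost and failure probability of algorithms -/

/-- Draw a uniformly random element of a nonempty finite type. -/
noncomputable def RoundAlg.draw {n : ℕ} (α : Type) [Fintype α] [Nonempty α]
    (next : α → RoundAlg n) : RoundAlg n :=
  .sample (Fintype.card α - 1) fun j =>
    next ((Fintype.equivFin α).symm (Fin.cast (Nat.sub_add_cancel Fintype.card_pos) j))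

/-- Submit one batch of comparisons indexed by an arbitrary finite type. -/
noncomputable def RoundAlg.ask {n : ℕ} {κ : Type} [Fintype κ] (queries : κ → Fin n × Fin n)
    (next : (κ → Fin n) → RoundAlg n) : RoundAlg n :=
  .round (Fintype.card κ) (queries ∘ (Fintype.equivFin κ).symm)
    fun ans => next (ans ∘ Fintype.equivFin κ)

/-- Every execution makes at most `c` comparisons in at most `R` rounds. -/
def RoundAlg.CostLE {n : ℕ} (x : Fin n → ℝ) (A : RoundAlg n) (c R : ℕ) : Prop :=
  ∀ σ past, ∀ o ∈ (A.run x σ past).support, o.comparisons ≤ c ∧ o.rounds ≤ R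

/-- Against every adversary and after every history, the returned item violates `Q` with
probability at most `δ`. -/
def RoundAlg.FailLE {n : ℕ} (x : Fin n → ℝ) (Q : Fin n → Prop) (A : RoundAlg n)
    (δ : ENNReal) : Prop :=
  ∀ σ past, (A.run x σ past).toOuterMeasure {o | ¬ Q o.item} ≤ δ

/-- The answer `ans` to the comparison `p` is one that the comparator can return. -/
def IsAnswer {n : ℕ} (x : Fin n → ℝ) (p : Fin n × Fin n) (ans : Fin n) : Prop :=
  ∃ b, ans = compareResult x b p

lemma IsAnswer.le_of_eq {n : ℕ} {x : Fin n → ℝ} {p : Fin n × Fin n} {ans : Fin n}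
    (h : IsAnswer x p ans) (h1 : ans = p.1) : x p.2 ≤ x p.1 + 1 := by
  obtain ⟨b, rfl⟩ := h
  unfold compareResult at h1
  split_ifs at h1 with h2 h3 h4
  · linarith
  · rw [h1]; linarith
  · have := (abs_le.1 (not_lt.1 h2)).1; linarith
  · rw [h1]; linarith

lemma IsAnswer.le_of_ne {n : ℕ} {x : Fin n → ℝ} {p : Fin n × Fin n} {ans : Fin n}
    (h : IsAnswer x p ans) (h1 : ans ≠ p.1) : x p.1 ≤ x p.2 + 1 := by
  obtain ⟨b, rfl⟩ := h
  unfold compareResult at h1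
  split_ifs at h1 with h2 h3 h4
  · exact absurd rfl h1
  · linarith
  · exact absurd rfl h1
  · have := (abs_le.1 (not_lt.1 h2)).2; linarith

namespace RoundAlg

variable {n : ℕ} {x : Fin n → ℝ} {Q : Fin n → Prop}

lemma costLE_output (item : Fin n) : CostLE x (.output item) 0 0 := by
  intro σ past o ho
  simp only [run, PMF.support_pure, Set.mem_singleton_iff] at ho
  simp [ho]

lemma failLE_output {item : Fin n} (h : Q item) : FailLE x Q (.output item) 0 := by
  intro σ past
  simp [run, h]

lemma CostLE.mono {A : RoundAlg n} {c R c' R' : ℕ} (h : CostLE x A c R) (hc : c ≤ c')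
    (hR : R ≤ R') : CostLE x A c' R' := fun σ past o ho =>
  ⟨(h σ past o ho).1.trans hc, (h σ past o ho).2.trans hR⟩

lemma FailLE.mono {A : RoundAlg n} {δ δ' : ENNReal} (h : FailLE x Q A δ) (hδ : δ ≤ δ') :
    FailLE x Q A δ' := fun σ past => (h σ past).trans hδ

lemma FailLE.imp {Q' : Fin n → Prop} {A : RoundAlg n} {δ : ENNReal} (h : FailLE x Q A δ)
    (hQ : ∀ item, Q item → Q' item) : FailLE x Q' A δ := by
  intro σ past
  refine le_trans (MeasureTheory.measure_mono ?_) (h σ past)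
  exact Set.ofPred_subset_ofPred.2 fun o ho hq => ho (hQ _ hq)

lemma failLE_one (A : RoundAlg n) : FailLE x Q A 1 := by
  intro σ past
  refine le_trans (MeasureTheory.measure_mono (Set.subset_univ _)) (le_of_eq ?_)
  rw [PMF.toOuterMeasure_apply_eq_one_iff]
  exact Set.subset_univ _

lemma costLE_draw {α : Type} [Fintype α] [Nonempty α] {next : α → RoundAlg n} {c R : ℕ}
    (h : ∀ a, CostLE x (next a) c R) : CostLE x (draw α next) c R := by
  intro σ past o ho
  simp only [draw, run, PMF.mem_support_bind_iff] at ho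
  obtain ⟨j, -, hj⟩ := ho
  exact h _ σ past o hj

lemma costLE_ask {κ : Type} [Fintype κ] {queries : κ → Fin n × Fin n}
    {next : (κ → Fin n) → RoundAlg n} {c R : ℕ}
    (h : ∀ ans, CostLE x (next ans) c R) :
    CostLE x (ask queries next) (c + Fintype.card κ) (R + 1) := by
  intro σ past o ho
  simp only [ask, run, PMF.mem_support_map_iff] at ho
  obtain ⟨o', ho', rfl⟩ := ho
  have := h _ σ _ o' ho'
  exact ⟨Nat.add_le_add_right this.1 _, Nat.add_le_add_right this.2 _⟩

lemma failLE_ask {κ : Type} [Fintype κ] {queries : κ → Fin n × Fin n}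
    {next : (κ → Fin n) → RoundAlg n} {δ : ENNReal}
    (h : ∀ ans, (∀ k, IsAnswer x (queries k) (ans k)) → FailLE x Q (next ans) δ) :
    FailLE x Q (ask queries next) δ := by
  intro σ past
  simp only [ask, run, PMF.toOuterMeasure_map_apply]
  refine h _ ?_ σ _
  intro k
  exact ⟨_, by simp [Function.comp]; rfl⟩

/-- A draw adds the proportion of bad values to the failure probability. -/
lemma failLE_draw {α : Type} [Fintype α] [Nonempty α] {next : α → RoundAlg n} {δ : ENNReal}
    {η : ℝ} (bad : Finset α) (hbad : (bad.card : ℝ) ≤ η * Fintype.card α)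
    (h : ∀ a, a ∉ bad → FailLE x Q (next a) δ) :
    FailLE x Q (draw α next) (ENNReal.ofReal η + δ) := by
  classical
  intro σ past
  have hpos : 0 < Fintype.card α := Fintype.card_pos
  have hcard : Fintype.card α - 1 + 1 = Fintype.card α := Nat.sub_add_cancel hpos
  set N := Fintype.card α with hN
  simp only [draw, run, PMF.toOuterMeasure_bind_apply, PMF.uniformOfFintype_apply,
    Fintype.card_fin, tsum_fintype]
  let e : Fin (N - 1 + 1) ≃ α := (finCongr hcard).trans (Fintype.equivFin α).symm
  have key : ∀ a : α, ((next a).run x σ past).toOuterMeasure {o | ¬ Q o.item} ≤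
      (if a ∈ bad then 1 else 0) + δ := by
    intro a
    split_ifs with ha
    · exact (failLE_one _ σ past).trans le_self_add
    · simpa using h a ha σ past
  have hN0 : (N : ENNReal) ≠ 0 := by exact_mod_cast hpos.ne'
  have hNt : (N : ENNReal) ≠ ⊤ := ENNReal.natCast_ne_top N
  calc _ ≤ ∑ j : Fin (N - 1 + 1), (((N - 1 + 1 : ℕ) : ENNReal))⁻¹ *
        ((if e j ∈ bad then 1 else 0) + δ) := by
        refine Finset.sum_le_sum fun j _ => ?_
        gcongr
        exact key (e j)
    _ = ∑ a : α, (N : ENNReal)⁻¹ * ((if a ∈ bad then 1 else 0) + δ) := by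
        have hcast : ((N - 1 + 1 : ℕ) : ENNReal) = N := by rw [hcard]
        rw [hcast]
        exact e.sum_comp fun a => (N : ENNReal)⁻¹ * ((if a ∈ bad then 1 else 0) + δ)
    _ = (N : ENNReal)⁻¹ * bad.card + δ := by
        rw [← Finset.mul_sum, Finset.sum_add_distrib, mul_add]
        simp only [Finset.sum_ite_mem, Finset.univ_inter, Finset.sum_const, nsmul_eq_mul, mul_one,
          Finset.card_univ, ← hN]
        rw [← mul_assoc, ENNReal.inv_mul_cancel hN0 hNt, one_mul]
    _ ≤ _ := by
        gcongr
        rw [mul_comm, ← div_eq_mul_inv]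
        refine ENNReal.div_le_of_le_mul ?_
        have hη : 0 ≤ η := by
          by_contra hneg
          have : (0:ℝ) < N := by exact_mod_cast hpos
          nlinarith [(Nat.cast_nonneg bad.card : (0:ℝ) ≤ bad.card)]
        rw [← ENNReal.ofReal_natCast, ← ENNReal.ofReal_natCast, ← ENNReal.ofReal_mul hη]
        exact ENNReal.ofReal_le_ofReal hbad

end RoundAlg

/-! ### Concentration -/

open Finset

/-- The upper tail of a sum of independent draws of a centred function with values in `[-1, 1]`, from
Markov's inequality for `exp (ε / 2 * ∑ k, g (a k))` and `exp t ≤ 1 + t + t ^ 2`. -/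
lemma card_sum_gt_le {α : Type*} [Fintype α] (g : α → ℝ) (hg : ∀ j, |g j| ≤ 1)
    (hsum : ∑ j, g j = 0) (d : ℕ) {ε : ℝ} (h0 : 0 ≤ ε) (h1 : ε ≤ 1) :
    (#{a : Fin d → α | ε * d < ∑ k, g (a k)} : ℝ) ≤
      Real.exp (-(ε ^ 2 * d / 4)) * Fintype.card (Fin d → α) := by
  set l := ε / 2 with hl
  have hmgf : ∑ a : Fin d → α, Real.exp (l * ∑ k, g (a k)) ≤
      Real.exp (l ^ 2 * d) * Fintype.card (Fin d → α) := by
    have h2 : ∑ j, Real.exp (l * g j) ≤ Real.exp (l ^ 2) * Fintype.card α := by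
      calc ∑ j, Real.exp (l * g j) ≤ ∑ j, (1 + l * g j + l ^ 2) := by
            refine sum_le_sum fun j _ => ?_
            have h3 : |l * g j| ≤ l := by
              rw [abs_mul, abs_of_nonneg (by positivity : 0 ≤ l)]
              nlinarith [hg j, abs_nonneg (g j)]
            have h4 := (abs_le.1 (Real.abs_exp_sub_one_sub_id_le (h3.trans (by linarith)))).2
            have h5 : (l * g j) ^ 2 ≤ l ^ 2 := by
              rw [← sq_abs]; gcongr
            linarith
        _ = (1 + l ^ 2) * Fintype.card α := by
            simp only [sum_add_distrib, ← mul_sum, hsum, sum_const, card_univ, nsmul_eq_mul]; ring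
        _ ≤ _ := by
            gcongr
            linarith [Real.add_one_le_exp (l ^ 2)]
    calc ∑ a : Fin d → α, Real.exp (l * ∑ k, g (a k))
        = (∑ j, Real.exp (l * g j)) ^ d := by
          rw [Fintype.sum_pow]
          refine sum_congr rfl fun a _ => ?_
          rw [mul_sum, Real.exp_sum]
      _ ≤ (Real.exp (l ^ 2) * Fintype.card α) ^ d :=
          pow_le_pow_left₀ (sum_nonneg fun _ _ => (Real.exp_pos _).le) h2 d
      _ = _ := by
          rw [mul_pow, ← Real.exp_nat_mul, Fintype.card_fun, Fintype.card_fin]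
          push_cast
          ring_nf
  have hmarkov : (#{a : Fin d → α | ε * d < ∑ k, g (a k)} : ℝ) * Real.exp (l * (ε * d)) ≤
      ∑ a : Fin d → α, Real.exp (l * ∑ k, g (a k)) := by
    rw [← nsmul_eq_mul]
    refine (card_nsmul_le_sum _ _ _ fun a ha => ?_).trans
      (sum_le_sum_of_subset_of_nonneg (filter_subset _ _) fun _ _ _ => (Real.exp_pos _).le)
    have := (mem_filter.1 ha).2
    gcongr
  have h6 := hmarkov.trans hmgf
  rw [← le_div_iff₀ (Real.exp_pos _), mul_div_right_comm, ← Real.exp_sub] at h6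
  refine h6.trans (le_of_eq ?_)
  congr 2
  rw [hl]; ring

/-- A Chernoff bound in counting form: `d` independent uniform draws hit a set `B` with the right
frequency up to `ε`, outside a small proportion of all outcomes. -/
lemma card_frequency_deviation_le {α : Type*} [Fintype α] [Nonempty α] [DecidableEq α]
    (B : Finset α) (d : ℕ) {ε : ℝ} (h0 : 0 ≤ ε) (h1 : ε ≤ 1) :
    (#{a : Fin d → α | ε * d < |(#{k | a k ∈ B} : ℝ) - d * (#B / Fintype.card α)|} : ℝ) ≤
      2 * Real.exp (-(ε ^ 2 * d / 4)) * Fintype.card (Fin d → α) := by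
  set p : ℝ := #B / Fintype.card α with hp
  have hα : (0 : ℝ) < Fintype.card α := by exact_mod_cast Fintype.card_pos
  have hp0 : 0 ≤ p := by positivity
  have hp1 : p ≤ 1 := by
    rw [hp, div_le_one hα]; exact_mod_cast card_le_univ B
  let g : α → ℝ := fun j => (if j ∈ B then 1 else 0) - p
  have hg : ∀ j, |g j| ≤ 1 := by
    intro j; rw [abs_le]; simp only [g]; split_ifs <;> constructor <;> linarith
  have hgs : ∑ j, g j = 0 := by
    simp only [g, sum_sub_distrib, sum_ite_mem, univ_inter, sum_const, card_univ, nsmul_eq_mul,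
      mul_one]
    rw [hp]; field_simp; ring
  have hcount : ∀ a : Fin d → α, ∑ k, g (a k) = (#{k | a k ∈ B} : ℝ) - d * p := by
    intro a
    simp [g, sum_sub_distrib]
  have hA := card_sum_gt_le g hg hgs d h0 h1
  have hB := card_sum_gt_le (fun j => -g j) (by simpa using hg) (by simp [hgs]) d h0 h1
  have hle : #{a : Fin d → α | ε * d < |(#{k | a k ∈ B} : ℝ) - d * p|} ≤
      #{a : Fin d → α | ε * d < ∑ k, g (a k)} + #{a : Fin d → α | ε * d < ∑ k, -g (a k)} := by
    refine (card_le_card fun a ha => ?_).trans (card_union_le _ _)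
    have h := (mem_filter.1 ha).2
    rw [← hcount] at h
    simp only [mem_union, mem_filter, mem_univ, true_and, sum_neg_distrib]
    exact lt_abs.1 h
  have hle' : (#{a : Fin d → α | ε * d < |(#{k | a k ∈ B} : ℝ) - d * p|} : ℝ) ≤ _ :=
    Nat.cast_le.2 hle
  push_cast at hle'
  linarith

/-! ### Scores in a random regular comparison graph -/

section Score

variable {m d : ℕ} [NeZero m]

/-- The shifts `a` hit `D` with the right frequency up to `1 / 100`, seen from every index `e` and
in both directions. -/
def WellSpread (a : Fin d → Fin m) (D : Finset (Fin m)) : Prop :=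
  ∀ e, |(#{k | e + a k ∈ D} : ℝ) - d * (#D / m)| ≤ d / 100 ∧
    |(#{k | e - a k ∈ D} : ℝ) - d * (#D / m)| ≤ d / 100

/-- The indices whose value exceeds that of `e` by at most `1`. -/
noncomputable def upTo (y : Fin m → ℝ) (e : Fin m) : Finset (Fin m) := {z | y z ≤ y e + 1}

/-- The indices whose value is below that of `e` by more than `1`. -/
noncomputable def under (y : Fin m → ℝ) (e : Fin m) : Finset (Fin m) := {z | y z < y e - 1}

/-- The shifts `a` are well spread for all sets on which the analysis of the values `y` relies. -/
def Representative (y : Fin m → ℝ) (a : Fin d → Fin m) : Prop :=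
  ∀ e, WellSpread a (upTo y e) ∧ WellSpread a (under y e)

open Classical in
lemma card_not_wellSpread_le (D : Finset (Fin m)) :
    (#{a : Fin d → Fin m | ¬ WellSpread a D} : ℝ) ≤
      4 * m * Real.exp (-(d / 40000)) * Fintype.card (Fin d → Fin m) := by
  have hdev : ∀ B : Finset (Fin m), #B = #D →
      (#{a : Fin d → Fin m | (d / 100 : ℝ) < |(#{k | a k ∈ B} : ℝ) - d * (#D / m)|} : ℝ) ≤
      2 * Real.exp (-(d / 40000)) * Fintype.card (Fin d → Fin m) := by
    intro B hB
    have h := card_frequency_deviation_le B d (ε := 1 / 100) (by norm_num) (by norm_num)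
    rw [hB, Fintype.card_fin m] at h
    have e1 : (1 / 100 : ℝ) * d = d / 100 := by ring
    have e2 : (1 / 100 : ℝ) ^ 2 * d / 4 = d / 40000 := by ring
    rwa [e1, e2] at h
  let S₁ : Fin m → Finset (Fin m) := fun e => D.map (Equiv.subRight e).toEmbedding
  let S₂ : Fin m → Finset (Fin m) := fun e => D.map (Equiv.subLeft e).toEmbedding
  have h₁ : ∀ e j, j ∈ S₁ e ↔ e + j ∈ D := by
    intro e j; simp [S₁, mem_map_equiv, add_comm]
  have h₂ : ∀ e j, j ∈ S₂ e ↔ e - j ∈ D := by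
    intro e j; simp [S₂, mem_map_equiv]; rw [neg_add_eq_sub]
  let X₁ : Fin m → Finset (Fin d → Fin m) := fun e =>
    {a | (d / 100 : ℝ) < |(#{k | a k ∈ S₁ e} : ℝ) - d * (#D / m)|}
  let X₂ : Fin m → Finset (Fin d → Fin m) := fun e =>
    {a | (d / 100 : ℝ) < |(#{k | a k ∈ S₂ e} : ℝ) - d * (#D / m)|}
  have hsub : ({a : Fin d → Fin m | ¬ WellSpread a D} : Finset _) ⊆
      univ.biUnion fun e => X₁ e ∪ X₂ e := by
    intro a ha
    have h := (mem_filter.1 ha).2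
    unfold WellSpread at h
    push Not at h
    obtain ⟨e, he⟩ := h
    simp only [mem_biUnion, mem_univ, true_and, mem_union, X₁, X₂, mem_filter, h₁, h₂]
    refine ⟨e, ?_⟩
    by_contra hcon
    rw [not_or, not_lt, not_lt] at hcon
    exact absurd hcon.2 (not_le.2 (he hcon.1))
  have hc := (card_le_card hsub).trans
    (card_biUnion_le.trans (sum_le_sum fun e _ => card_union_le (X₁ e) (X₂ e)))
  have hc' : (#{a : Fin d → Fin m | ¬ WellSpread a D} : ℝ) ≤
      ∑ e : Fin m, ((#(X₁ e) : ℝ) + #(X₂ e)) := by exact_mod_cast hc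
  refine hc'.trans ((sum_le_sum fun e _ => add_le_add (hdev (S₁ e) (card_map _))
    (hdev (S₂ e) (card_map _))).trans (le_of_eq ?_))
  simp only [sum_const, card_univ, Fintype.card_fin, nsmul_eq_mul]
  ring

open Classical in
lemma card_not_representative_le (y : Fin m → ℝ) :
    (#{a : Fin d → Fin m | ¬ Representative y a} : ℝ) ≤
      8 * m ^ 2 * Real.exp (-(d / 40000)) * Fintype.card (Fin d → Fin m) := by
  have hsub : ({a : Fin d → Fin m | ¬ Representative y a} : Finset _) ⊆
      univ.biUnion fun e => ({a | ¬ WellSpread a (upTo y e)} : Finset (Fin d → Fin m)) ∪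
        ({a | ¬ WellSpread a (under y e)} : Finset (Fin d → Fin m)) := by
    intro a ha
    have h := (mem_filter.1 ha).2
    unfold Representative at h
    push Not at h
    obtain ⟨e, he⟩ := h
    simp only [mem_biUnion, mem_univ, true_and, mem_union, mem_filter]
    exact ⟨e, by tauto⟩
  have hc := (card_le_card hsub).trans
    (card_biUnion_le.trans (sum_le_sum fun e _ => card_union_le _ _))
  have hc' : (#{a : Fin d → Fin m | ¬ Representative y a} : ℝ) ≤
      ∑ e : Fin m, ((#{a : Fin d → Fin m | ¬ WellSpread a (upTo y e)} : ℝ) +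
        #{a : Fin d → Fin m | ¬ WellSpread a (under y e)}) := by exact_mod_cast hc
  refine hc'.trans ((sum_le_sum fun e _ => add_le_add (card_not_wellSpread_le _)
    (card_not_wellSpread_le _)).trans (le_of_eq ?_))
  simp only [sum_const, card_univ, Fintype.card_fin, nsmul_eq_mul]
  ring

open Classical in
/-- The number of comparisons won by `e` when each index `f` is compared with `f + a k` for all `k`
and `W f k` says that `f` wins. The index `e` takes part once as `f = e` and once as the opponent
of `f = e - a k`, for each `k`. -/
noncomputable def score (a : Fin d → Fin m) (W : Fin m → Fin d → Prop) (e : Fin m) : ℕ :=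
  #{k | W e k} + #{k | ¬ W (e - a k) k}

/-- The outcomes `W` of the comparisons are possible for the values `y`. -/
structure Consistent (y : Fin m → ℝ) (a : Fin d → Fin m) (W : Fin m → Fin d → Prop) : Prop where
  le_of_win : ∀ e k, W e k → y (e + a k) ≤ y e + 1
  le_of_loss : ∀ e k, ¬ W e k → y e ≤ y (e + a k) + 1

open Classical in
/-- Each comparison inside `D` has exactly one winner. -/
lemma sum_wins_inside (a : Fin d → Fin m) (W : Fin m → Fin d → Prop) (D : Finset (Fin m)) :
    ∑ e ∈ D, (#{k | W e k ∧ e + a k ∈ D} + #{k | ¬ W (e - a k) k ∧ e - a k ∈ D}) =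
      ∑ e ∈ D, #{k | e + a k ∈ D} := by
  have h1 : ∀ (P : Fin m → Fin d → Prop) [∀ e k, Decidable (P e k)], ∑ e ∈ D, #{k | P e k} =
      ∑ k, ∑ e : Fin m, if e ∈ D ∧ P e k then 1 else 0 := by
    intro P _
    rw [sum_comm, ← sum_filter_add_sum_filter_not univ (· ∈ D)]
    have : ∀ e ∈ ({e | e ∉ D} : Finset (Fin m)),
        ∑ k, (if e ∈ D ∧ P e k then 1 else 0) = 0 := by
      intro e he
      simp [(mem_filter.1 he).2]
    rw [sum_eq_zero this, add_zero]
    simp only [filter_mem_eq_inter, univ_inter]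
    refine sum_congr rfl fun e he => ?_
    rw [card_filter]
    simp only [he, true_and]
  rw [sum_add_distrib, h1, h1, h1, ← sum_add_distrib]
  refine sum_congr rfl fun k _ => ?_
  refine (congrArg _ (Fintype.sum_equiv (Equiv.subRight (a k)) _
    (fun f => if f + a k ∈ D ∧ ¬ W f k ∧ f ∈ D then 1 else 0) fun e => by simp)).trans ?_
  rw [← sum_add_distrib]
  refine sum_congr rfl fun e _ => ?_
  by_cases hW : W e k <;> by_cases h2 : e ∈ D <;> by_cases h3 : e + a k ∈ D <;> simp [hW, h2, h3]

lemma sum_score (a : Fin d → Fin m) (W : Fin m → Fin d → Prop) : ∑ e, score a W e = m * d := by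
  classical
  have := sum_wins_inside a W univ
  simpa [score] using this

omit [NeZero m] in
lemma score_le_two_mul (a : Fin d → Fin m) (W : Fin m → Fin d → Prop) (e : Fin m) :
    score a W e ≤ 2 * d := by
  classical
  have h1 : #{k | W e k} ≤ d := (card_le_univ _).trans (by simp)
  have h2 : #{k | ¬ W (e - a k) k} ≤ d := (card_le_univ _).trans (by simp)
  unfold score
  omega

variable {y : Fin m → ℝ} {a : Fin d → Fin m} {W : Fin m → Fin d → Prop}

lemma score_le (hR : Representative y a) (hW : Consistent y a W) (e : Fin m) :
    (score a W e : ℝ) ≤ 2 * d * (#(upTo y e) / m) + d / 50 := by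
  classical
  obtain ⟨h1, h2⟩ := (hR e).1 e
  have h3 : #{k | W e k} ≤ #{k | e + a k ∈ upTo y e} :=
    card_le_card fun k hk => by
      simp only [mem_filter, mem_univ, true_and, upTo] at hk ⊢
      exact hW.le_of_win e k hk
  have h4 : #{k | ¬ W (e - a k) k} ≤ #{k | e - a k ∈ upTo y e} :=
    card_le_card fun k hk => by
      simp only [mem_filter, mem_univ, true_and, upTo] at hk ⊢
      simpa using hW.le_of_loss _ k hk
  have h5 : (score a W e : ℝ) ≤ #{k | e + a k ∈ upTo y e} + #{k | e - a k ∈ upTo y e} := by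
    exact_mod_cast Nat.add_le_add h3 h4
  linarith [(abs_le.1 h1).2, (abs_le.1 h2).2]

lemma le_score (hR : Representative y a) (hW : Consistent y a W) (e : Fin m) :
    2 * d * (#(under y e) / m) - d / 50 ≤ (score a W e : ℝ) := by
  classical
  obtain ⟨h1, h2⟩ := (hR e).2 e
  have h3 : #{k | e + a k ∈ under y e} ≤ #{k | W e k} :=
    card_le_card fun k hk => by
      simp only [mem_filter, mem_univ, true_and, under] at hk ⊢
      by_contra hcon
      linarith [hW.le_of_loss e k hcon]
  have h4 : #{k | e - a k ∈ under y e} ≤ #{k | ¬ W (e - a k) k} :=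
    card_le_card fun k hk => by
      simp only [mem_filter, mem_univ, true_and, under] at hk ⊢
      intro hcon
      have := hW.le_of_win _ k hcon
      rw [sub_add_cancel] at this
      linarith
  have h5 : (#{k | e + a k ∈ under y e} : ℝ) + #{k | e - a k ∈ under y e} ≤ score a W e := by
    exact_mod_cast Nat.add_le_add h3 h4
  linarith [(abs_le.1 h1).1, (abs_le.1 h2).1]

/-- A clear difference of scores reveals the order of the values up to `2`. -/
lemma le_of_score_lt (hR : Representative y a) (hW : Consistent y a W) {e f : Fin m}
    (h : 25 * score a W e + d < 25 * score a W f) : y e ≤ y f + 2 := by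
  by_contra! hcon
  have h1 := le_score hR hW e
  have h2 := score_le hR hW f
  have h3 : #(upTo y f) ≤ #(under y e) := card_le_card fun z hz => by
    simp only [mem_filter, mem_univ, true_and, under, upTo] at hz ⊢
    linarith
  have h3' : 2 * d * ((#(upTo y f) : ℝ) / m) ≤ 2 * d * (#(under y e) / m) := by gcongr
  have h' : (25 * score a W e + d : ℝ) < 25 * score a W f := by exact_mod_cast h
  linarith

/-- The indices up to `f` cannot win more than half of the comparisons among themselves, and win
none outside of those under `e` if the values of `e` and `f` differ by more than `3`. -/
lemma sum_score_upTo_le (hR : Representative y a) (hW : Consistent y a W) {e f : Fin m}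
    (h : y f + 3 < y e) :
    (∑ z ∈ upTo y f, (score a W z : ℝ)) ≤ #(upTo y f) *
      (d * (#(upTo y f) / m) + d / 100 + 2 * d * (#(under y e) / m - #(upTo y f) / m) + d / 25) := by
  classical
  set D := upTo y f with hD
  set E := under y e with hE
  have hDE : D ⊆ E := fun z hz => by
    simp only [hD, hE, mem_filter, mem_univ, true_and, under, upTo] at hz ⊢
    linarith
  have hsplit : ∀ z ∈ D, (score a W z : ℝ) ≤
      ((#{k | W z k ∧ z + a k ∈ D} + #{k | ¬ W (z - a k) k ∧ z - a k ∈ D} : ℕ) : ℝ) +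
      (2 * d * (#E / m - #D / m) + d / 25) := by
    intro z hz
    have hzy : y z ≤ y f + 1 := by simpa [hD, upTo] using hz
    obtain ⟨d1, d2⟩ := (hR f).1 z
    obtain ⟨e1, e2⟩ := (hR e).2 z
    rw [← hD] at d1 d2
    rw [← hE] at e1 e2
    have c1 : #{k | W z k} + #{k | z + a k ∈ D} ≤
        #{k | W z k ∧ z + a k ∈ D} + #{k | z + a k ∈ E} := by
      rw [← card_union_add_card_inter, add_comm, ← filter_and, ← filter_or]
      refine Nat.add_le_add_left (card_le_card fun k hk => ?_) _
      simp only [mem_filter, mem_univ, true_and] at hk ⊢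
      rcases hk with hk | hk
      · have := hW.le_of_win z k hk
        simp only [hE, under, mem_filter, mem_univ, true_and]
        linarith
      · exact hDE hk
    have c2 : #{k | ¬ W (z - a k) k} + #{k | z - a k ∈ D} ≤
        #{k | ¬ W (z - a k) k ∧ z - a k ∈ D} + #{k | z - a k ∈ E} := by
      rw [← card_union_add_card_inter, add_comm, ← filter_and, ← filter_or]
      refine Nat.add_le_add_left (card_le_card fun k hk => ?_) _
      simp only [mem_filter, mem_univ, true_and] at hk ⊢
      rcases hk with hk | hk
      · have := hW.le_of_loss _ k hk
        rw [sub_add_cancel] at this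
        simp only [hE, under, mem_filter, mem_univ, true_and]
        linarith
      · exact hDE hk
    have c3 : (score a W z : ℝ) + #{k | z + a k ∈ D} + #{k | z - a k ∈ D} ≤
      ((#{k | W z k ∧ z + a k ∈ D} + #{k | ¬ W (z - a k) k ∧ z - a k ∈ D} : ℕ) : ℝ) +
        #{k | z + a k ∈ E} + #{k | z - a k ∈ E} := by
      have : score a W z + #{k | z + a k ∈ D} + #{k | z - a k ∈ D} ≤
        (#{k | W z k ∧ z + a k ∈ D} + #{k | ¬ W (z - a k) k ∧ z - a k ∈ D}) +
        #{k | z + a k ∈ E} + #{k | z - a k ∈ E} := by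
        unfold score; omega
      exact_mod_cast this
    linarith [(abs_le.1 d1).1, (abs_le.1 d2).1, (abs_le.1 e1).2, (abs_le.1 e2).2]
  refine (sum_le_sum hsplit).trans ?_
  rw [sum_add_distrib, ← Nat.cast_sum, sum_wins_inside, Nat.cast_sum, sum_const, nsmul_eq_mul]
  have hin : ∑ z ∈ D, (#{k | z + a k ∈ D} : ℝ) ≤ ∑ z ∈ D, (d * ((#D : ℝ) / m) + d / 100) := by
    refine sum_le_sum fun z _ => ?_
    linarith [(abs_le.1 ((hR f).1 z).1).2]
  rw [sum_const, nsmul_eq_mul] at hin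
  linarith

end Score

/-! ### Balanced approximate cuts -/

section Cut

variable {m : ℕ}

/-- The `q` indices of lowest score, ties being broken by a fixed sorting permutation. -/
noncomputable def lowest (w : Fin m → ℕ) (q : ℕ) : Finset (Fin m) :=
  {e | ((Tuple.sort w).symm e : ℕ) < q}

/-- The `q` indices of highest score, ties being broken by a fixed sorting permutation. -/
noncomputable def highest (w : Fin m → ℕ) (q : ℕ) : Finset (Fin m) :=
  {e | m - q ≤ ((Tuple.sort w).symm e : ℕ)}

lemma sort_symm_le {w : Fin m → ℕ} {e f : Fin m}
    (h : (Tuple.sort w).symm e ≤ (Tuple.sort w).symm f) : w e ≤ w f := by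
  simpa using Tuple.monotone_sort w h

lemma card_lowest (w : Fin m → ℕ) {q : ℕ} (hq : q ≤ m) : #(lowest w q) = q := by
  have : lowest w q = ({i : Fin m | (i : ℕ) < q} : Finset _).map (Tuple.sort w).toEmbedding := by
    ext e; simp [lowest, mem_map_equiv]
  rw [this, card_map, Fin.card_filter_val_lt, min_eq_right hq]

lemma card_highest (w : Fin m → ℕ) {q : ℕ} (hq : q ≤ m) : #(highest w q) = q := by
  have : highest w q = (lowest w (m - q))ᶜ := by
    ext e; simp [lowest, highest]
  rw [this, card_compl, card_lowest w (Nat.sub_le _ _), Fintype.card_fin]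
  omega

lemma le_of_mem_lowest {w : Fin m → ℕ} {q : ℕ} {e f : Fin m} (he : e ∈ lowest w q)
    (hf : f ∉ lowest w q) : w e ≤ w f := by
  simp only [lowest, mem_filter, mem_univ, true_and] at he hf
  exact sort_symm_le (Fin.le_def.2 (by omega))

lemma le_of_mem_highest {w : Fin m → ℕ} {q : ℕ} {e f : Fin m} (he : e ∉ highest w q)
    (hf : f ∈ highest w q) : w e ≤ w f := by
  simp only [highest, mem_filter, mem_univ, true_and] at he hf
  exact sort_symm_le (Fin.le_def.2 (by omega))

lemma disjoint_lowest_highest (w : Fin m → ℕ) {q : ℕ} (hq : 2 * q ≤ m) :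
    Disjoint (lowest w q) (highest w q) := by
  rw [disjoint_left]
  intro e he hf
  simp only [lowest, highest, mem_filter, mem_univ, true_and] at he hf
  omega

/-- The score of a pivot is clearly above the lowest and clearly below the highest sixteenth. -/
def IsPivot (d : ℕ) (w : Fin m → ℕ) (p : Fin m) : Prop :=
  (∀ a ∈ lowest w (m / 16), 25 * w a + d < 25 * w p) ∧
    ∀ b ∈ highest w (m / 16), 25 * w p + d < 25 * w b

open Classical in
/-- A pivot, or an arbitrary index if there is none. -/
noncomputable def pivot [NeZero m] (d : ℕ) (w : Fin m → ℕ) : Fin m :=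
  if h : ∃ p, IsPivot d w p then h.choose else 0

open Classical in
/-- The lower part of the cut that is made on seeing the scores `w` and the indices that beat the
pivot. Without a pivot the cut is made at a gap between the scores if there is one, and otherwise
all scores are so close that the lowest sixteenth can be split off. -/
noncomputable def lowerPart (d : ℕ) (w : Fin m → ℕ) (beats : Fin m → Prop) : Finset (Fin m) :=
  if ∃ p, IsPivot d w p then
    if 2 * #{e | ¬ beats e} ≤ m then ({e | ¬ beats e} : Finset (Fin m)) ∪ lowest w (m / 16)
    else ({e | ¬ beats e} : Finset (Fin m)) \ highest w (m / 16)
  else if ∀ a ∈ lowest w (m / 16), ∀ b ∈ highest w (m / 16), 25 * w a + 3 * d < 25 * w b then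
    ({e | ∃ a ∈ lowest w (m / 16), 25 * w e ≤ 25 * w a + d} : Finset (Fin m))
  else lowest w (m / 16)

/-- Both parts of a cut hold at least a sixteenth of the indices, whatever the answers are. -/
lemma card_lowerPart (d : ℕ) (w : Fin m → ℕ) (beats : Fin m → Prop) :
    m / 16 ≤ #(lowerPart d w beats) ∧ #(lowerPart d w beats) + m / 16 ≤ m := by
  classical
  have hq : m / 16 ≤ m := Nat.div_le_self _ _
  have hl := card_lowest w hq
  have hh := card_highest w hq
  unfold lowerPart
  split_ifs with h1 h2 h3
  · have c1 := card_le_card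
      (subset_union_right (s₁ := ({e | ¬ beats e} : Finset (Fin m))) (s₂ := lowest w (m / 16)))
    have c2 := card_union_le ({e | ¬ beats e} : Finset (Fin m)) (lowest w (m / 16))
    omega
  · have c1 := le_card_sdiff (highest w (m / 16)) ({e | ¬ beats e} : Finset (Fin m))
    have c2 : Disjoint (({e | ¬ beats e} : Finset (Fin m)) \ highest w (m / 16))
      (highest w (m / 16)) := sdiff_disjoint
    have c3 := card_le_univ
      ((({e | ¬ beats e} : Finset (Fin m)) \ highest w (m / 16)) ∪ highest w (m / 16))
    rw [card_union_of_disjoint c2, Fintype.card_fin] at c3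
    omega
  · have c1 : lowest w (m / 16) ⊆
        ({e | ∃ a ∈ lowest w (m / 16), 25 * w e ≤ 25 * w a + d} : Finset (Fin m)) := by
      intro e he
      simp only [mem_filter, mem_univ, true_and]
      exact ⟨e, he, Nat.le_add_right _ _⟩
    have c2 : Disjoint ({e | ∃ a ∈ lowest w (m / 16), 25 * w e ≤ 25 * w a + d} : Finset (Fin m))
        (highest w (m / 16)) := by
      rw [disjoint_left]
      intro e he hf
      simp only [mem_filter, mem_univ, true_and] at he
      obtain ⟨a, ha, hle⟩ := he
      have := h3 a ha e hf
      omega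
    have c3 := card_le_univ
      (({e | ∃ a ∈ lowest w (m / 16), 25 * w e ≤ 25 * w a + d} : Finset (Fin m)) ∪
        highest w (m / 16))
    rw [card_union_of_disjoint c2, Fintype.card_fin] at c3
    have c4 := card_le_card c1
    omega
  · omega

variable [NeZero m] {d : ℕ} {y : Fin m → ℝ} {a : Fin d → Fin m} {W : Fin m → Fin d → Prop}

/-- If nearly all scores agree up to `3 / 50` of the degree, then splitting off the lowest ones
makes an error of at most `3`. Otherwise the set `D` of indices with values up to `y f + 1` would
be almost as large as the score of `e` suggests, and its members would win almost only among
themselves, which gives them about half of the score of `e` on average; but all of them outside the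
lowest sixteenth have at least the score of `e`, which is about half of the degree. -/
lemma le_of_concentrated (hR : Representative y a) (hW : Consistent y a W) (hm : 16 ≤ m)
    (hd : 0 < d) {a₀ b₀ e f : Fin m} (ha₀ : a₀ ∈ lowest (score a W) (m / 16))
    (hb₀ : b₀ ∈ highest (score a W) (m / 16))
    (hclose : 25 * score a W b₀ ≤ 25 * score a W a₀ + 3 * d)
    (he : e ∈ lowest (score a W) (m / 16)) (hf : f ∉ lowest (score a W) (m / 16)) :
    y e ≤ y f + 3 := by
  by_contra! hcon
  set w := score a W with hw
  set q := m / 16 with hqdef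
  have hq : q ≤ m := Nat.div_le_self _ _
  have hmR : (0 : ℝ) < m := by exact_mod_cast (by omega : 0 < m)
  have hdR : (0 : ℝ) < d := by exact_mod_cast hd
  have hqR : (16 * q : ℝ) ≤ m := by exact_mod_cast (by omega : 16 * q ≤ m)
  have htot : m * d ≤ m * w b₀ + 2 * q * d := by
    have h1 : ∀ z, w z ≤ w b₀ + if z ∈ highest w q then 2 * d else 0 := by
      intro z
      split_ifs with hz
      · exact (score_le_two_mul a W z).trans (Nat.le_add_left _ _)
      · exact (le_of_mem_highest hz hb₀).trans (Nat.le_add_right _ _)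
    calc m * d = ∑ z, w z := (sum_score a W).symm
      _ ≤ ∑ z, (w b₀ + if z ∈ highest w q then 2 * d else 0) := sum_le_sum fun z _ => h1 z
      _ = m * w b₀ + 2 * q * d := by
        simp only [sum_add_distrib, sum_const, card_univ, Fintype.card_fin, smul_eq_mul,
          sum_ite_mem, univ_inter, card_highest w hq]
        ring
  have hbase := sum_score_upTo_le hR hW hcon
  have h1 := le_score hR hW e
  have h2 := score_le hR hW f
  have hsub : #(upTo y f) ≤ #(under y e) := card_le_card fun z hz => by
    simp only [mem_filter, mem_univ, true_and, under, upTo] at hz ⊢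
    linarith
  have hef : w e ≤ w f := le_of_mem_lowest he hf
  -- all scores outside `lowest w q` are at least that of `e`
  have hlow : (w e : ℝ) * (#(upTo y f) - q) ≤ ∑ z ∈ upTo y f, (w z : ℝ) := by
    have h3 : ∀ z, (w e : ℝ) - (if z ∈ lowest w q then (w e : ℝ) else 0) ≤ w z := by
      intro z
      split_ifs with hz
      · simp
      · simpa using le_of_mem_lowest he hz
    refine le_trans ?_ (sum_le_sum fun z (_ : z ∈ upTo y f) => h3 z)
    rw [sum_sub_distrib, sum_const, nsmul_eq_mul, sum_ite_mem, sum_const, nsmul_eq_mul]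
    have h4 : #(upTo y f ∩ lowest w q) ≤ q :=
      (card_le_card inter_subset_right).trans (card_lowest w hq).le
    have h4' : (#(upTo y f ∩ lowest w q) : ℝ) ≤ q := by exact_mod_cast h4
    nlinarith [(Nat.cast_nonneg (w e) : (0 : ℝ) ≤ w e)]
  have hclose' : 25 * w f ≤ 25 * w e + d ∨ 25 * w e + d < 25 * w f := le_or_gt _ _
  have hfe : 25 * w f ≤ 25 * w e + d := by
    rcases hclose' with h | h
    · exact h
    · linarith [le_of_score_lt hR hW h]
  have ha₀f : w a₀ ≤ w f := le_of_mem_lowest ha₀ hf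
  -- normalization by the degree `2 * d` and by `m`
  set s : ℝ := w e / (2 * d) with hs
  set u : ℝ := #(upTo y f) / m with hu
  set v : ℝ := #(under y e) / m with hv
  have hwe : (w e : ℝ) = 2 * d * s := by
    rw [hs, mul_comm, div_mul_cancel₀ _ (by positivity)]
  have hU : (#(upTo y f) : ℝ) = m * u := by
    rw [hu, mul_comm, div_mul_cancel₀ _ hmR.ne']
  have hs1 : v ≤ s + 1 / 100 := by
    have : 2 * d * v ≤ 2 * d * (s + 1 / 100) := by linarith
    exact le_of_mul_le_mul_left this (by positivity)
  have hs2 : s ≤ u + 1 / 100 := by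
    have hef' : (w e : ℝ) ≤ w f := by exact_mod_cast hef
    have : 2 * d * s ≤ 2 * d * (u + 1 / 100) := by linarith
    exact le_of_mul_le_mul_left this (by positivity)
  have huv : u ≤ v := by
    rw [hu, hv]; gcongr
  have hshalf : 7 / 20 ≤ s := by
    have c1 : (25 * w b₀ : ℝ) ≤ 25 * w e + 4 * d := by
      exact_mod_cast (by omega : 25 * w b₀ ≤ 25 * w e + 4 * d)
    have c2 : (m * d : ℝ) ≤ m * w b₀ + 2 * q * d := by exact_mod_cast htot
    have c3 : (m : ℝ) * (w b₀ : ℝ) ≤ m * (2 * d * s + 4 / 25 * d) := by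
      gcongr; linarith
    have c4 : (2 * q * d : ℝ) ≤ m * d / 8 := by nlinarith
    have : (m * d : ℝ) * (7 / 20) ≤ m * d * s := by nlinarith [mul_pos hmR hdR]
    exact le_of_mul_le_mul_left this (by positivity)
  have hmain : s * (u - 1 / 16) ≤ u * (u / 2 + (v - u) + 1 / 40) := by
    have c1 : (2 * d * s) * (m * u - q) ≤
        m * u * (d * u + d / 100 + 2 * d * (v - u) + d / 25) := by
      rw [← hwe, ← hU]; exact hlow.trans hbase
    have c2 : (2 * d * s) * (m * u - m / 16) ≤ (2 * d * s) * (m * u - q) := by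
      gcongr; linarith
    have : (2 * d * m) * (s * (u - 1 / 16)) ≤
        (2 * d * m) * (u * (u / 2 + (v - u) + 1 / 40)) := by nlinarith
    exact le_of_mul_le_mul_left this (by positivity)
  nlinarith [mul_nonneg (sub_nonneg.2 hs2) (sub_nonneg.2 hshalf)]

/-- For a representative sample, no value in the lower part of the cut exceeds a value in the upper
part by more than `4`. -/
lemma lowerPart_le (hR : Representative y a) (hW : Consistent y a W) (hm : 16 ≤ m) (hd : 0 < d)
    {beats : Fin m → Prop}
    (hbeats : ∀ e, beats e → y (pivot d (score a W)) ≤ y e + 1)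
    (hloses : ∀ e, ¬ beats e → y e ≤ y (pivot d (score a W)) + 1) {e f : Fin m}
    (he : e ∈ lowerPart d (score a W) beats) (hf : f ∉ lowerPart d (score a W) beats) :
    y e ≤ y f + 4 := by
  classical
  set w := score a W with hw
  by_cases h1 : ∃ p, IsPivot d w p
  · have hp : IsPivot d w (pivot d w) := by
      rw [pivot, dif_pos h1]; exact h1.choose_spec
    by_cases h2 : 2 * #{e | ¬ beats e} ≤ m
    · simp only [lowerPart, if_pos h1, if_pos h2, mem_union, mem_filter, mem_univ, true_and,
        not_or, not_not] at he hf
      have hfp := hbeats f hf.1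
      rcases he with he | he
      · linarith [hloses e he]
      · linarith [le_of_score_lt hR hW (hp.1 e he)]
    · simp only [lowerPart, if_pos h1, if_neg h2, mem_sdiff, mem_filter, mem_univ, true_and,
        not_and, not_not] at he hf
      have hep := hloses e he.1
      by_cases hfb : beats f
      · linarith [hbeats f hfb]
      · linarith [le_of_score_lt hR hW (hp.2 f (hf hfb))]
  · by_cases h3 : ∀ a ∈ lowest w (m / 16), ∀ b ∈ highest w (m / 16), 25 * w a + 3 * d < 25 * w b
    · simp only [lowerPart, if_neg h1, if_pos h3, mem_filter, mem_univ, true_and,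
        not_exists, not_and, not_le] at he hf
      obtain ⟨a₁, ha₁, hle⟩ := he
      have hnp : ¬ IsPivot d w f := fun h => h1 ⟨f, h⟩
      have : ∃ b ∈ highest w (m / 16), 25 * w b ≤ 25 * w f + d := by
        by_contra! hcon
        exact hnp ⟨hf, hcon⟩
      obtain ⟨b, hb, hbf⟩ := this
      have := h3 a₁ ha₁ b hb
      linarith [le_of_score_lt hR hW (by omega : 25 * w e + d < 25 * w f)]
    · simp only [lowerPart, if_neg h1, if_neg h3] at he hf
      push Not at h3
      obtain ⟨a₀, ha₀, b₀, hb₀, hle⟩ := h3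
      linarith [le_of_concentrated hR hW hm hd ha₀ hb₀ hle he hf]

end Cut

/-! ### Approximate selection by counting -/

section Good

variable {m : ℕ}

/-- The index `j` is an approximate selection for rank `r` among the values `y`, expressed by
counting the values that are clearly smaller and clearly larger. -/
def IsGood (y : Fin m → ℝ) (r : ℕ) (j : Fin m) : Prop :=
  #{z | y z < y j - 4} ≤ r ∧ r + #{z | y j + 4 < y z} < m

lemma IsGood.of_lower {y : Fin m → ℝ} {A : Finset (Fin m)} (hA : ∀ e ∈ A, ∀ f ∉ A, y e ≤ y f + 4)
    {r : ℕ} {j : Fin #A} (h : IsGood (y ∘ A.orderEmbOfFin rfl) r j) :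
    IsGood y r (A.orderEmbOfFin rfl j) := by
  classical
  set g := A.orderEmbOfFin rfl with hg
  have hmem : ∀ i, g i ∈ A := A.orderEmbOfFin_mem rfl
  have hsurj : ∀ z ∈ A, ∃ i, g i = z := fun z hz => by
    have := A.range_orderEmbOfFin rfl
    have hz' : z ∈ Set.range (A.orderEmbOfFin rfl) := by rw [this]; exact hz
    exact hz'
  obtain ⟨h1, h2⟩ := h
  have c1 : ({z | y z < y (g j) - 4} : Finset (Fin m)) ⊆
      image g {i | (y ∘ g) i < (y ∘ g) j - 4} := by
    intro z hz
    simp only [mem_filter, mem_univ, true_and, mem_image, Function.comp] at hz ⊢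
    by_cases hzA : z ∈ A
    · obtain ⟨i, rfl⟩ := hsurj z hzA
      exact ⟨i, hz, rfl⟩
    · linarith [hA _ (hmem j) z hzA]
  have c2 : ({z | y (g j) + 4 < y z} : Finset (Fin m)) ⊆
      image g {i | (y ∘ g) j + 4 < (y ∘ g) i} ∪ Aᶜ := by
    intro z hz
    simp only [mem_filter, mem_univ, true_and, mem_image, Function.comp, mem_union,
      mem_compl] at hz ⊢
    by_cases hzA : z ∈ A
    · obtain ⟨i, rfl⟩ := hsurj z hzA
      exact Or.inl ⟨i, hz, rfl⟩
    · exact Or.inr hzA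
  have d1 := (card_le_card c1).trans card_image_le
  have d2 := (card_le_card c2).trans ((card_union_le _ _).trans
    (Nat.add_le_add_right card_image_le _))
  have d3 := card_add_card_compl A
  rw [Fintype.card_fin] at d3
  exact ⟨d1.trans h1, by omega⟩

lemma IsGood.of_upper {y : Fin m → ℝ} {A : Finset (Fin m)} (hA : ∀ e ∈ A, ∀ f ∉ A, y e ≤ y f + 4)
    {r : ℕ} (hr : #A ≤ r) {j : Fin #Aᶜ} (h : IsGood (y ∘ Aᶜ.orderEmbOfFin rfl) (r - #A) j) :
    IsGood y r (Aᶜ.orderEmbOfFin rfl j) := by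
  classical
  set g := Aᶜ.orderEmbOfFin rfl with hg
  have hmem : ∀ i, g i ∉ A := fun i => mem_compl.1 (Aᶜ.orderEmbOfFin_mem rfl i)
  have hsurj : ∀ z ∉ A, ∃ i, g i = z := fun z hz => by
    have := Aᶜ.range_orderEmbOfFin rfl
    have hz' : z ∈ Set.range (Aᶜ.orderEmbOfFin rfl) := by
      rw [this]; exact mem_coe.2 (mem_compl.2 hz)
    exact hz'
  obtain ⟨h1, h2⟩ := h
  have c1 : ({z | y z < y (g j) - 4} : Finset (Fin m)) ⊆
      image g {i | (y ∘ g) i < (y ∘ g) j - 4} ∪ A := by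
    intro z hz
    simp only [mem_filter, mem_univ, true_and, mem_image, Function.comp, mem_union] at hz ⊢
    by_cases hzA : z ∈ A
    · exact Or.inr hzA
    · obtain ⟨i, rfl⟩ := hsurj z hzA
      exact Or.inl ⟨i, hz, rfl⟩
  have c2 : ({z | y (g j) + 4 < y z} : Finset (Fin m)) ⊆
      image g {i | (y ∘ g) j + 4 < (y ∘ g) i} := by
    intro z hz
    simp only [mem_filter, mem_univ, true_and, mem_image, Function.comp] at hz ⊢
    by_cases hzA : z ∈ A
    · linarith [hA z hzA _ (hmem j)]
    · obtain ⟨i, rfl⟩ := hsurj z hzA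
      exact ⟨i, hz, rfl⟩
  have d1 := (card_le_card c1).trans ((card_union_le _ _).trans
    (Nat.add_le_add_right card_image_le _))
  have d2 := (card_le_card c2).trans card_image_le
  have d3 := card_add_card_compl A
  rw [Fintype.card_fin] at d3
  exact ⟨by omega, by omega⟩

lemma rank_sort (w : Fin m → ℕ) (r : Fin m) :
    #{z | w z < w (Tuple.sort w r)} ≤ (r : ℕ) ∧
      (r : ℕ) + #{z | w (Tuple.sort w r) < w z} < m := by
  classical
  have h1 : ({z | w z < w (Tuple.sort w r)} : Finset (Fin m)) ⊆
      (Iio r).map (Tuple.sort w).toEmbedding := by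
    intro z hz
    simp only [mem_filter, mem_univ, true_and, mem_map_equiv, mem_Iio] at hz ⊢
    by_contra! hcon
    have := Tuple.monotone_sort w hcon
    simp only [Function.comp, Equiv.apply_symm_apply] at this
    omega
  have h2 : ({z | w (Tuple.sort w r) < w z} : Finset (Fin m)) ⊆
      (Ioi r).map (Tuple.sort w).toEmbedding := by
    intro z hz
    simp only [mem_filter, mem_univ, true_and, mem_map_equiv, mem_Ioi] at hz ⊢
    by_contra! hcon
    have := Tuple.monotone_sort w hcon
    simp only [Function.comp, Equiv.apply_symm_apply] at this
    omega
  have c1 := card_le_card h1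
  have c2 := card_le_card h2
  rw [card_map, Fin.card_Iio] at c1
  rw [card_map, Fin.card_Ioi] at c2
  have := r.isLt
  exact ⟨c1, by omega⟩

/-- A good index becomes the item at position `i` when, in an exact sorting, it is swapped with the
item at position `i`: their values differ by at most `4`. -/
lemma IsGood.isApproxSelection {n : ℕ} {x : Fin n → ℝ} {i j : Fin n} (h : IsGood x i j) :
    IsApproxSelection x 4 i j := by
  classical
  obtain ⟨h1, h2⟩ := h
  set s := Tuple.sort x with hs
  have hmono : ∀ p q, p ≤ q → x (s p) ≤ x (s q) := fun p q hpq => Tuple.monotone_sort x hpq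
  have hlow : x j - 4 ≤ x (s i) := by
    by_contra! hcon
    have : (Iic i).map s.toEmbedding ⊆ ({z | x z < x j - 4} : Finset (Fin n)) := by
      intro z hz
      simp only [mem_map_equiv, mem_Iic, mem_filter, mem_univ, true_and] at hz ⊢
      have := hmono _ _ hz
      rw [Equiv.apply_symm_apply] at this
      linarith
    have := card_le_card this
    rw [card_map, Fin.card_Iic] at this
    omega
  have hhigh : x (s i) ≤ x j + 4 := by
    by_contra! hcon
    have : (Ici i).map s.toEmbedding ⊆ ({z | x j + 4 < x z} : Finset (Fin n)) := by
      intro z hz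
      simp only [mem_map_equiv, mem_Ici, mem_filter, mem_univ, true_and] at hz ⊢
      have := hmono _ _ hz
      rw [Equiv.apply_symm_apply] at this
      linarith
    have := card_le_card this
    rw [card_map, Fin.card_Ici] at this
    omega
  set t := s.symm j with ht
  have hst : s t = j := Equiv.apply_symm_apply _ _
  refine ⟨(Equiv.swap t i).trans s, ?_, by simp [hst]⟩
  intro a b hab
  simp only [Equiv.trans_apply, Equiv.swap_apply_def]
  have hab' := hmono a b hab.le
  split_ifs with h3 h4 h5 h6 h7 h8 h9 <;> subst_vars <;>
    simp only [hst] at * <;> linarith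

end Good

/-! ### The selection algorithm -/

section Algorithm

variable {n : ℕ}

open Classical in
/-- Compare all pairs in one round and return the item of rank `r` by number of wins. -/
noncomputable def tournament {m : ℕ} (v : Fin m → Fin n) (r : Fin m) : RoundAlg n :=
  .ask (fun p : Fin m × Fin m => (v p.1, v p.2)) fun ans =>
    .output (v (Tuple.sort (fun e => #{f | ans (e, f) = v e}) r))

/-- Selection of rank `r` among the `m` items listed by `v`, with `d` random shifts in each stage
and at most `T` stages. A stage compares each index `e` with its shifts `e + a k`, then all indices
with a pivot, and keeps the part of the resulting cut that holds rank `r`. -/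
noncomputable def select (d : ℕ) : ℕ → (m : ℕ) → (Fin m → Fin n) → Fin m → RoundAlg n
  | 0, _, v, r => tournament v r
  | T + 1, m, v, r =>
    haveI : NeZero m := ⟨(Fin.pos r).ne'⟩
    if 16 ≤ m then
      .draw (Fin d → Fin m) fun a =>
      .ask (fun s : Fin m × Fin d => (v s.1, v (s.1 + a s.2))) fun ans =>
      let w := score a fun e k => ans (e, k) = v e
      .ask (fun e : Fin m => (v e, v (pivot d w))) fun ans' =>
      let A := lowerPart d w fun e => ans' e = v e
      if hr : (r : ℕ) < #A then
        select d T #A (v ∘ A.orderEmbOfFin rfl) ⟨r, hr⟩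
      else
        select d T #Aᶜ (v ∘ Aᶜ.orderEmbOfFin rfl) ⟨r - #A, by
          have := card_add_card_compl A
          rw [Fintype.card_fin] at this
          have := r.isLt
          omega⟩
    else tournament v r

variable {x : Fin n → ℝ}

lemma costLE_tournament {m : ℕ} (v : Fin m → Fin n) (r : Fin m) :
    RoundAlg.CostLE x (tournament v r) (m * m) 1 :=
  (RoundAlg.costLE_ask fun _ => RoundAlg.costLE_output _).mono (by simp) le_rfl

lemma failLE_tournament {m : ℕ} (v : Fin m → Fin n) (r : Fin m) :
    RoundAlg.FailLE x (fun item => ∃ j, item = v j ∧ IsGood (x ∘ v) r j) (tournament v r) 0 := by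
  classical
  refine RoundAlg.failLE_ask fun ans hans => RoundAlg.failLE_output ⟨_, rfl, ?_⟩
  set w : Fin m → ℕ := fun e => #{f | ans (e, f) = v e} with hw
  have hlt : ∀ e j : Fin m, x (v e) + 4 < x (v j) → w e < w j := by
    intro e j hej
    refine card_lt_card ⟨fun f hf => ?_, fun hsub => ?_⟩
    · simp only [mem_filter, mem_univ, true_and] at hf ⊢
      by_contra hcon
      have h1 : x (v f) ≤ x (v e) + 1 := (hans (e, f)).le_of_eq hf
      have h2 : x (v j) ≤ x (v f) + 1 := (hans (j, f)).le_of_ne hcon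
      linarith
    · have hj : j ∈ ({f | ans (j, f) = v j} : Finset (Fin m)) := by
        obtain ⟨b, hb⟩ := hans (j, j)
        simp [hb, compareResult]
      have := hsub hj
      simp only [mem_filter, mem_univ, true_and] at this
      have h1 : x (v j) ≤ x (v e) + 1 := (hans (e, j)).le_of_eq this
      linarith
  obtain ⟨h1, h2⟩ := rank_sort w r
  refine ⟨(card_le_card fun z hz => ?_).trans h1,
    (Nat.add_le_add_left (card_le_card fun z hz => ?_) _).trans_lt h2⟩
  · simp only [mem_filter, mem_univ, true_and, Function.comp] at hz ⊢
    exact hlt _ _ (by linarith)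
  · simp only [mem_filter, mem_univ, true_and, Function.comp] at hz ⊢
    exact hlt _ _ hz

/-- A stage costs `m * (d + 1)` comparisons and removes at least `m / 32` of the `m` items, so that
the total is bounded by a geometric series. -/
lemma costLE_select (d T : ℕ) : ∀ (m : ℕ) (v : Fin m → Fin n) (r : Fin m),
    m * 31 ^ T < 16 * 32 ^ T →
    RoundAlg.CostLE x (select d T m v r) (32 * (d + 1) * m + 256) (2 * T + 1) := by
  have hbase : ∀ (m : ℕ) (v : Fin m → Fin n) (r : Fin m) (R : ℕ), m < 16 →
      RoundAlg.CostLE x (tournament v r) (32 * (d + 1) * m + 256) (R + 1) := by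
    intro m v r R hm
    exact (costLE_tournament v r).mono (by nlinarith [Nat.zero_le (32 * (d + 1) * m)]) (by omega)
  induction T with
  | zero => intro m v r hm; exact hbase m v r 0 (by simpa using hm)
  | succ T ih =>
    intro m v r hT
    have : NeZero m := ⟨(Fin.pos r).ne'⟩
    unfold select
    split_ifs with hm
    · have hstep : ∀ m' : ℕ, m' + m / 16 ≤ m → m' * 31 ^ T < 16 * 32 ^ T ∧
          32 * (d + 1) * m' + 256 + m + m * d ≤ 32 * (d + 1) * m + 256 := by
        intro m' hm'
        have h32 : 32 * m' ≤ 31 * m := by omega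
        constructor
        · have : 32 * (m' * 31 ^ T) < 32 * (16 * 32 ^ T) := by
            calc 32 * (m' * 31 ^ T) = (32 * m') * 31 ^ T := by ring
              _ ≤ (31 * m) * 31 ^ T := Nat.mul_le_mul_right _ h32
              _ = m * 31 ^ (T + 1) := by ring
              _ < 16 * 32 ^ (T + 1) := hT
              _ = 32 * (16 * 32 ^ T) := by ring
          omega
        · nlinarith [Nat.mul_le_mul_left (d + 1) h32]
      refine RoundAlg.costLE_draw fun a => ?_
      refine (RoundAlg.costLE_ask (c := 32 * (d + 1) * m + 256 - m * d) (R := 2 * T + 2)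
        fun ans => ?_).mono ?_ (by omega)
      swap
      · have := (hstep 0 (by omega)).2
        simp only [Fintype.card_prod, Fintype.card_fin]
        omega
      refine (RoundAlg.costLE_ask (c := 32 * (d + 1) * m + 256 - m * d - m) (R := 2 * T + 1)
        fun ans' => ?_).mono ?_ (by omega)
      swap
      · have := (hstep 0 (by omega)).2
        simp only [Fintype.card_fin]
        omega
      have hA := card_lowerPart d (score a fun e k => ans (e, k) = v e) fun e => ans' e = v e
      have hAc := card_add_card_compl
        (lowerPart d (score a fun e k => ans (e, k) = v e) fun e => ans' e = v e)
      rw [Fintype.card_fin] at hAc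
      dsimp only
      split_ifs with hr
      · have h := hstep _ hA.2
        exact (ih _ _ _ h.1).mono (by omega) le_rfl
      · have h := hstep
          #(lowerPart d (score a fun e k => ans (e, k) = v e) fun e => ans' e = v e)ᶜ (by omega)
        exact (ih _ _ _ h.1).mono (by omega) le_rfl
    · exact hbase m v r _ (by omega)

/-- Each stage fails at most with the probability that its sample is not representative. -/
lemma failLE_select {d : ℕ} (hd : 0 < d) (T : ℕ) : ∀ (m : ℕ) (v : Fin m → Fin n) (r : Fin m),
    m ≤ n →
    RoundAlg.FailLE x (fun item => ∃ j, item = v j ∧ IsGood (x ∘ v) r j) (select d T m v r)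
      (T * ENNReal.ofReal (8 * n ^ 2 * Real.exp (-(d / 40000)))) := by
  classical
  set δ := ENNReal.ofReal (8 * n ^ 2 * Real.exp (-(d / 40000))) with hδ
  induction T with
  | zero =>
    intro m v r _
    exact (failLE_tournament v r).mono zero_le
  | succ T ih =>
    intro m v r hmn
    have : NeZero m := ⟨(Fin.pos r).ne'⟩
    unfold select
    split_ifs with hm
    swap
    · exact (failLE_tournament v r).mono zero_le
    have hsplit : ((T + 1 : ℕ) : ENNReal) * δ = δ + T * δ := by push_cast; ring
    rw [hsplit]
    refine RoundAlg.failLE_draw {a | ¬ Representative (x ∘ v) a} ?_ fun a ha => ?_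
    · refine (card_not_representative_le (x ∘ v)).trans ?_
      gcongr
    have hR : Representative (x ∘ v) a := by
      simpa only [mem_filter, mem_univ, true_and, not_not] using ha
    refine RoundAlg.failLE_ask fun ans hans => ?_
    refine RoundAlg.failLE_ask fun ans' hans' => ?_
    have hW : Consistent (x ∘ v) a fun e k => ans (e, k) = v e :=
      ⟨fun e k h => (hans (e, k)).le_of_eq h, fun e k h => (hans (e, k)).le_of_ne h⟩
    have hcut := fun (e : Fin m) he (f : Fin m) hf => lowerPart_le hR hW hm hd
      (beats := fun e => ans' e = v e) (fun e h => (hans' e).le_of_eq h)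
      (fun e h => (hans' e).le_of_ne h) (e := e) (f := f) he hf
    have hAc := card_add_card_compl
      (lowerPart d (score a fun e k => ans (e, k) = v e) fun e => ans' e = v e)
    rw [Fintype.card_fin] at hAc
    dsimp only
    split_ifs with hr
    · refine (ih _ _ _ (by omega)).imp ?_
      rintro item ⟨j, rfl, hj⟩
      exact ⟨_, rfl, IsGood.of_lower hcut hj⟩
    · refine (ih _ _ _ (by omega)).imp ?_
      rintro item ⟨j, rfl, hj⟩
      exact ⟨_, rfl, IsGood.of_upper hcut (not_lt.1 hr) hj⟩

end Algorithm

theorem corollary1p2 :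
    ∃ C : ℝ, ∀ (n : ℕ) (i : Fin n), ∃ A : RoundAlg n,
      ∀ (x : Fin n → ℝ) (σ : Adversary n),
        (∀ o ∈ (A.run x σ []).support,
          (o.comparisons : ℝ) ≤ C * (n * Real.log n) ∧ (o.rounds : ℝ) ≤ C * Real.log n) ∧
        1 - 1 / (n : ℝ) ^ 2 <
          ((A.run x σ []).toOuterMeasure {o | IsApproxSelection x 4 i o.item}).toReal := by
  refine ⟨20000000, fun n i => ?_⟩
  rcases Nat.lt_or_ge n 2 with hn | hn
  · -- no comparison is allowed for a single item, since `log 1 = 0`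
    obtain rfl : n = 1 := by have := i.isLt; omega
    refine ⟨.output i, fun x σ => ⟨fun o ho => ?_, ?_⟩⟩
    · simpa using RoundAlg.costLE_output (x := x) i σ [] o ho
    · have : IsApproxSelection x 4 i i :=
        ⟨Equiv.refl _, fun a b hab => by omega, rfl⟩
      simp [RoundAlg.run, this]
  have hn2 : (2 : ℝ) ≤ n := by exact_mod_cast hn
  have hn0 : (0 : ℝ) < n := by linarith
  set L := Real.log n with hL
  have hL1 : 1 / 2 ≤ L := by
    have := Real.log_le_log (by norm_num) hn2
    linarith [Real.log_two_gt_d9]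
  -- `560000 = 14 * 40000` makes the failure probability of one stage at most `8 / n ^ 12`
  set d := ⌈560000 * L⌉₊ with hd
  set T := ⌈32 * L⌉₊ with hT
  have hd1 : 560000 * L ≤ d := Nat.le_ceil _
  have hd2 : (d : ℝ) ≤ 560002 * L := by
    have := Nat.ceil_lt_add_one (by positivity : 0 ≤ 560000 * L)
    linarith
  have hT1 : 32 * L ≤ T := Nat.le_ceil _
  have hT2 : (T : ℝ) ≤ 34 * L := by
    have := Nat.ceil_lt_add_one (by positivity : 0 ≤ 32 * L)
    linarith
  have hdpos : 0 < d := by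
    have : (0 : ℝ) < d := by linarith
    exact_mod_cast this
  -- `T` stages suffice to come down to fewer than `16` items
  have hstages : n * 31 ^ T < 16 * 32 ^ T := by
    have h1 : (31 / 32 : ℝ) ^ T ≤ 1 / n := by
      calc (31 / 32 : ℝ) ^ T ≤ Real.exp (-(1 / 32)) ^ T := by
            gcongr
            linarith [Real.add_one_le_exp (-(1 / 32) : ℝ)]
        _ = Real.exp (-(T / 32)) := by rw [← Real.exp_nat_mul]; ring_nf
        _ ≤ Real.exp (-L) := Real.exp_le_exp.2 (by linarith)
        _ = 1 / n := by rw [Real.exp_neg, Real.exp_log hn0, one_div]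
    have h2 : (n : ℝ) * 31 ^ T ≤ 32 ^ T := by
      rw [div_pow, div_le_div_iff₀ (by positivity) hn0] at h1
      linarith
    have h3 : (n * 31 ^ T : ℝ) < 16 * 32 ^ T := by
      have : (0 : ℝ) < 32 ^ T := by positivity
      linarith
    exact_mod_cast h3
  refine ⟨select d T n id i, fun x σ => ⟨fun o ho => ?_, ?_⟩⟩
  · obtain ⟨hc, hr⟩ := costLE_select (x := x) d T n id i hstages σ [] o ho
    have hc' : (o.comparisons : ℝ) ≤ 32 * (d + 1) * n + 256 := by exact_mod_cast hc
    have hr' : (o.rounds : ℝ) ≤ 2 * T + 1 := by exact_mod_cast hr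
    constructor
    · have h1 : 1 ≤ n * L := by nlinarith
      have h2 : (d + 1 : ℝ) * n ≤ 560004 * L * n := by gcongr; linarith
      linarith
    · linarith
  · set P := ((select d T n id i).run x σ []).toOuterMeasure with hP
    set good : Set (Outcome n) := {o | IsApproxSelection x 4 i o.item} with hgood
    have hbad : P goodᶜ ≤ T * ENNReal.ofReal (8 * n ^ 2 * Real.exp (-(d / 40000))) := by
      refine RoundAlg.FailLE.imp (Q' := IsApproxSelection x 4 i)
        (failLE_select (x := x) hdpos T n id i le_rfl) ?_ σ []
      rintro item ⟨j, rfl, hj⟩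
      exact hj.isApproxSelection
    have hsmall : (T : ℝ) * (8 * n ^ 2 * Real.exp (-(d / 40000))) < 1 / (n : ℝ) ^ 2 := by
      have h1 : Real.exp (-(d / 40000)) ≤ 1 / n ^ 14 := by
        calc Real.exp (-(d / 40000)) ≤ Real.exp (-((14 : ℕ) * L)) :=
              Real.exp_le_exp.2 (by push_cast; linarith)
          _ = 1 / n ^ 14 := by rw [Real.exp_neg, Real.exp_nat_mul, Real.exp_log hn0, one_div]
      have h2 : (T : ℝ) ≤ 34 * n := by
        linarith [Real.log_le_self hn0.le]
      calc (T : ℝ) * (8 * n ^ 2 * Real.exp (-(d / 40000)))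
          ≤ 34 * n * (8 * n ^ 2 * (1 / (n : ℝ) ^ 14)) := by gcongr
        _ = 272 / (n : ℝ) ^ 9 * (1 / (n : ℝ) ^ 2) := by field_simp; norm_num
        _ < 1 * (1 / (n : ℝ) ^ 2) := by
          gcongr
          rw [div_lt_one (by positivity)]
          have : (2 : ℝ) ^ 9 ≤ (n : ℝ) ^ 9 := by gcongr
          linarith
        _ = 1 / (n : ℝ) ^ 2 := one_mul _
    have hone : ∀ s, P s ≤ 1 := fun s => by
      have := RoundAlg.failLE_one (x := x) (Q := fun _ => False) (select d T n id i) σ []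
      exact (MeasureTheory.measure_mono (by simp)).trans this
    have htotal : 1 ≤ P good + P goodᶜ := by
      rw [← (PMF.toOuterMeasure_apply_eq_one_iff _ (s := Set.univ)).2 (Set.subset_univ _),
        ← Set.union_compl_self good]
      exact MeasureTheory.measure_union_le _ _
    have hg : P good ≠ ⊤ := ((hone _).trans_lt ENNReal.one_lt_top).ne
    have hb : P goodᶜ ≠ ⊤ := ((hone _).trans_lt ENNReal.one_lt_top).ne
    have h1 : 1 ≤ (P good).toReal + (P goodᶜ).toReal := by
      rw [← ENNReal.toReal_add hg hb]
      simpa using ENNReal.toReal_mono (ENNReal.add_ne_top.2 ⟨hg, hb⟩) htotal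
    have h2 : (P goodᶜ).toReal ≤ T * (8 * n ^ 2 * Real.exp (-(d / 40000))) := by
      have := ENNReal.toReal_mono (by finiteness) hbad
      rwa [ENNReal.toReal_mul, ENNReal.toReal_natCast,
        ENNReal.toReal_ofReal (by positivity)] at this
    linarith
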